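/- Conventions. A numbered graph $(\Gamma,N)$ is a finite simplicial graph $\Gamma$ with a map $N:V\Gamma\to\{2,3,4,\dots\}$. Its numbered graph product is the group $$\mathrm{NGP}(\Gamma,N)=\langle v\in V\Gamma \mid v^{N(v)}=1\ (v\in V\Gamma),\ uv=vu\ (\{u,v\}\in E\Gamma)\rangle,$$ with standard generating set $S=V\Gamma\cup (V\Gamma)^{-1}$ (a subset of the group). A word over $S$ is geodesic if no shorter word over $S$ represents the same group element, and the geodesic growth series is $\sum_{m\ge 0}g_mz^m$, where $g_m$ is the number of geodesic words of length $m$. For $U\subseteq V\Gamma$ let $N(U)$ be the multiset $\{N(v)\mid v\in U\}$. The link of a (possibly empty) clique $\sigma$ is $\mathrm{Lk}(\sigma)=\{v\in V\Gamma\setminus\sigma\mid \{v\}\cup\sigma\text{ is a clique}\}$. The numbered graph $(\Gamma,N)$ is link-regular if $N(\sigma)=N(\tau)$ implies $N(\mathrm{Lk}(\sigma))=N(\mathrm{Lk}(\tau))$ for all cliques $\sigma,\tau$. Two link-regular numbered graphs $(\Gamma,N)$, $(\Gamma',N')$ are equivalent if $N(V\Gamma)=N'(V\Gamma')$ and, for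 all cliques $\sigma$ of $\Gamma$ and $\sigma'$ of $\Gamma'$, $N(\sigma)=N'(\sigma')$ implies $N(\mathrm{Lk}(\sigma))=N'(\mathrm{Lk}(\sigma'))$. Corollary 5.16. (1) There are infinitely many pairs of numbered graph products associated to non-isomorphic graphs that have the same geodesic growth series. More precisely, there are numbered graphs $(\Gamma_i,N_i)$ and $(\Gamma_i',N_i')$, $i\in\{0,1,2,\dots\}$, such that the groups $\mathrm{NGP}(\Gamma_i,N_i)$ are pairwise non-isomorphic and, for every $i$, the graphs $\Gamma_i$ and $\Gamma_i'$ are not isomorphic, $(\Gamma_i,N_i)$ and $(\Gamma_i',N_i')$ are link-regular and equivalent, and their numbered graph products have the same geodesic growth series. (2) Let $k\ge 2$ and $n\ge 4$ be integers and let $N_0,\dots,N_{n-1}\ge 2$ be integers. Let $C$ be the $n$-cycle whose vertices are consecutively numbered $N_0,\dots,N_{n-1}$, let $\Gamma$ be the disjoint union of $k$ copies of $C$, and let $\Gamma'$ be the $kn$-cycle whose vertices are consecutively numbered by the sequence $N_0,\dots,N_{n-1}$ repeated $k$ times. Then the underlying graphs of $\Gamma$ and $\Gamma'$ are not isomorphic,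 and $\mathrm{NGP}(\Gamma)$ and $\mathrm{NGP}(\Gamma')$ have the same geodesic growth series. If $C$ is link-regular, then $\Gamma$ and $\Gamma'$ are link-regular and equivalent. The numbered cycle $C$ is link-regular if, for example, the $N_i$ are pairwise distinct or all equal. -/

import Mathlib

/-- A (finite) numbered graph: a finite simplicial graph together with an assignment of an integer
greater than one to every vertex. -/
structure NumberedGraph where
  V : Type
  [fintypeV : Fintype V]
  graph : SimpleGraph V
  num : V → ℕ
  two_le_num : ∀ v, 2 ≤ num v

attribute [instance] NumberedGraph.fintypeV

/-! ### Geodesic growth of a group with respect to a generating set -/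

/-- The growth series of a language: the coefficient of `z ^ n` is the number of words of length
`n` in the language. -/
noncomputable def Language.growthSeries {α : Type*} (L : Language α) : PowerSeries ℤ :=
  PowerSeries.mk fun n => ({w : List α | w ∈ L ∧ w.length = n}.ncard : ℤ)

/-- The cardinality occurring in the growth series is that of a finite set, if the alphabet is
finite. -/
theorem Language.finite_length_eq {α : Type*} [Finite α] (L : Language α) (n : ℕ) :
    {w : List α | w ∈ L ∧ w.length = n}.Finite :=
  (List.finite_length_eq α n).subset fun _ hw => hw.2

/-- The evaluation map sending a word over `S` to the product of its letters. -/
def evalWord {G : Type*} [Group G] (S : Set G) (w : List S) : G :=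
  (w.map Subtype.val).prod

/-- The geodesic language of `(G, S)`: the words over `S` such that no shorter word over `S`
evaluates to the same element. -/
def geodesicLanguage {G : Type*} [Group G] (S : Set G) : Language S :=
  {w : List S | ∀ y : List S, evalWord S y = evalWord S w → w.length ≤ y.length}

namespace NumberedGraph

/-! ### Numbered graph products -/

/-- The defining relators: `v ^ N(v)` for every vertex `v`, and the commutator of `u` and `v` for
every edge `{u, v}`. -/
def relators (Γ : NumberedGraph) : Set (FreeGroup Γ.V) :=
  {r | ∃ v, r = FreeGroup.of v ^ Γ.num v} ∪
    {r | ∃ u v, Γ.graph.Adj u v ∧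
      r = FreeGroup.of u * FreeGroup.of v * (FreeGroup.of u)⁻¹ * (FreeGroup.of v)⁻¹}

/-- The numbered graph product associated to a numbered graph. -/
abbrev NGP (Γ : NumberedGraph) : Type := PresentedGroup Γ.relators

/-- The standard generating set: all vertices and their inverses, as a set of group elements. -/
def stdGen (Γ : NumberedGraph) : Set Γ.NGP :=
  {g | ∃ v, g = PresentedGroup.of v ∨ g = (PresentedGroup.of v)⁻¹}

theorem finite_stdGen (Γ : NumberedGraph) : Γ.stdGen.Finite := by
  refine ((Set.finite_range fun v : Γ.V => (PresentedGroup.of v : Γ.NGP)).union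
    (Set.finite_range fun v : Γ.V => (PresentedGroup.of v : Γ.NGP)⁻¹)).subset ?_
  rintro g ⟨v, rfl | rfl⟩
  · exact Or.inl ⟨v, rfl⟩
  · exact Or.inr ⟨v, rfl⟩

/-- The geodesic growth series of the numbered graph product, with respect to its standard
generating set. -/
noncomputable def geodesicGrowth (Γ : NumberedGraph) : PowerSeries ℤ :=
  (geodesicLanguage Γ.stdGen).growthSeries

/-! ### Link-regularity and equivalence -/

/-- The multiset of vertex numbers of a set of vertices. -/
def numbers (Γ : NumberedGraph) (U : Finset Γ.V) : Multiset ℕ := U.val.map Γ.num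

open Classical in
/-- The link of a clique `σ`: the vertices outside of `σ` that form a clique together with `σ`. -/
noncomputable def link (Γ : NumberedGraph) (σ : Finset Γ.V) : Finset Γ.V :=
  {v | v ∉ σ ∧ Γ.graph.IsClique (insert v (σ : Set Γ.V))}

/-- Link-regularity: the vertex numbers of a clique determine those of its link. -/
def LinkRegular (Γ : NumberedGraph) : Prop :=
  ∀ σ τ : Finset Γ.V, Γ.graph.IsClique (σ : Set Γ.V) → Γ.graph.IsClique (τ : Set Γ.V) →
    Γ.numbers σ = Γ.numbers τ → Γ.numbers (Γ.link σ) = Γ.numbers (Γ.link τ)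

/-- Equivalence of two numbered graphs, a notion used for link-regular ones. -/
structure Equivalent (Γ Γ' : NumberedGraph) : Prop where
  numbers_univ : Γ.numbers Finset.univ = Γ'.numbers Finset.univ
  numbers_link : ∀ (σ : Finset Γ.V) (σ' : Finset Γ'.V),
    Γ.graph.IsClique (σ : Set Γ.V) → Γ'.graph.IsClique (σ' : Set Γ'.V) →
    Γ.numbers σ = Γ'.numbers σ' → Γ.numbers (Γ.link σ) = Γ'.numbers (Γ'.link σ')

/-! ### Cycles and disjoint copies -/

/-- The cycle with `n` vertices, numbered consecutively by `N 0, N 1, …, N (n - 1)`. -/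
def cycle (n : ℕ) (N : Fin n → ℕ) (hN : ∀ i, 2 ≤ N i) : NumberedGraph where
  V := Fin n
  graph := SimpleGraph.cycleGraph n
  num := N
  two_le_num := hN

/-- The cycle with `k * n` vertices, numbered consecutively by the sequence
`N 0, N 1, …, N (n - 1)` repeated `k` times (`j.modNat` is the residue of `j` modulo `n`). -/
def repeatedCycle (k n : ℕ) (N : Fin n → ℕ) (hN : ∀ i, 2 ≤ N i) : NumberedGraph :=
  cycle (k * n) (fun j => N j.modNat) (fun j => hN j.modNat)

/-- The disjoint union of `k` copies of a numbered graph. -/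
def copies (k : ℕ) (Γ : NumberedGraph) : NumberedGraph where
  V := Fin k × Γ.V
  graph :=
    { Adj := fun a b => a.1 = b.1 ∧ Γ.graph.Adj a.2 b.2
      symm := ⟨fun _ _ h => ⟨h.1.symm, h.2.symm⟩⟩
      loopless := ⟨fun _ h => h.2.ne rfl⟩ }
  num := fun a => Γ.num a.2
  two_le_num := fun a => Γ.two_le_num a.2

end NumberedGraph

/-! Both graphs in the example are `k`-fold coverings of one triangle-free numbered graph, the cycle
with `n ≥ 4` vertices. The geodesic growth of such a covering depends only on `k` and the base
(`geodesicGrowth_eq_of_isCovering`).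

Geodesics are recognized by an automaton whose state records, for every vertex, the integer exponent
of the syllable that can be shuffled to the end of the word; its support is a clique. A letter is
rejected when it fails to lengthen its syllable to a geodesic power. A rejected word can be
shortened (`exists_shorter_of_not_accepts`). An accepted word is geodesic because the group acts on
configurations of lamps: a letter raises the total brightness by at most one, and along an accepted
word by exactly one (`totalBrightness_of_accepts`).

Over a triangle-free base, the neighbourhood of a clique lifts to a section of the covering. Hence
over each base vertex one lift behaves as prescribed by the projected state, while the other `k - 1`
behave as if read from the zero state. This gives a recursion for the number of accepted words in
terms of the base alone (`ncard_acceptedWords_eq_coverCount`). The same sections compare links, so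
link-regularity and equivalence follow from link-regularity of the base.

For infinitely many pairs, constant numbers on two squares and on the octagon suffice; cyclic
quotients tell the groups apart. -/

namespace NumberedGraph

/-! ### Configurations of lamps and cursors -/

/-- A configuration: for every vertex `v`, the position of a cursor on a line of lamps, and
finitely many lit lamps with values in `ZMod (Γ.num v)`. -/
abbrev Config (Γ : NumberedGraph) : Type :=
  (Γ.V → ℤ) × (∀ v, ℤ →₀ ZMod (Γ.num v))

open Classical in
/-- The indicator of a lamp being lit. -/
noncomputable def lit {n : ℕ} (b : ZMod n) : ℤ := if b = 0 then 0 else 1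

open Classical in
/-- Add `a` to the lamp of `v` under its cursor; if that lamp is switched on (off), the cursors
of all vertices not commuting with `v` move forward (backward). -/
noncomputable def toggle (Γ : NumberedGraph) (v : Γ.V) (a : ZMod (Γ.num v)) (P : Γ.Config) :
    Γ.Config :=
  (fun w => if w = v ∨ Γ.graph.Adj v w then P.1 w else
      P.1 w + (lit (P.2 v (P.1 v) + a) - lit (P.2 v (P.1 v))),
    Function.update P.2 v (P.2 v + Finsupp.single (P.1 v) a))

variable {Γ : NumberedGraph}

@[simp] theorem toggle_zero (v : Γ.V) (P : Γ.Config) : Γ.toggle v 0 P = P := by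
  refine Prod.ext ?_ ?_ <;> simp [toggle]

/-- The cursor of `v` itself does not move, so both toggles hit the same lamp, and the differences
of `lit` telescope. -/
theorem toggle_toggle (v : Γ.V) (a b : ZMod (Γ.num v)) (P : Γ.Config) :
    Γ.toggle v a (Γ.toggle v b P) = Γ.toggle v (b + a) P := by
  refine Prod.ext ?_ ?_
  · funext w
    by_cases h : w = v ∨ Γ.graph.Adj v w
    · simp [toggle, h]
    · simp [toggle, h, add_assoc]
  · simp [toggle, add_assoc]

/-- Adjacent vertices neither move each other's cursors nor share lamps; their shifts of the
remaining cursors add up. -/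
theorem toggle_comm {u v : Γ.V} (h : Γ.graph.Adj u v) (a : ZMod (Γ.num u))
    (b : ZMod (Γ.num v)) (P : Γ.Config) :
    Γ.toggle u a (Γ.toggle v b P) = Γ.toggle v b (Γ.toggle u a P) := by
  classical
  have h1 := h.ne
  have h2 := h.symm
  refine Prod.ext ?_ ?_
  · funext w
    simp only [toggle, h, h2, or_true, if_true, Function.update_of_ne h1,
      Function.update_of_ne h1.symm]
    split_ifs <;> ring
  · simp only [toggle, h, h2, or_true, if_true, Function.update_of_ne h1,
      Function.update_of_ne h1.symm]
    exact Function.update_comm h1.symm _ _ _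

/-- `toggle` as a permutation. -/
noncomputable def togglePerm (v : Γ.V) (a : ZMod (Γ.num v)) : Equiv.Perm Γ.Config where
  toFun := Γ.toggle v a
  invFun := Γ.toggle v (-a)
  left_inv P := by simp [toggle_toggle]
  right_inv P := by simp [toggle_toggle]

theorem togglePerm_pow (v : Γ.V) (a : ZMod (Γ.num v)) (m : ℕ) :
    togglePerm v a ^ m = togglePerm v (m * a) := by
  induction m with
  | zero => ext1 P; simp [togglePerm]
  | succ m ih =>
    ext1 P
    rw [pow_succ', Equiv.Perm.mul_apply, ih]
    simp only [togglePerm, Equiv.coe_fn_mk, toggle_toggle]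
    congr 1
    push_cast
    ring

/-- The right action of the numbered graph product on configurations. -/
noncomputable def configHom (Γ : NumberedGraph) : Γ.NGP →* (Equiv.Perm Γ.Config)ᵐᵒᵖ :=
  PresentedGroup.toGroup (f := fun v => MulOpposite.op (togglePerm v 1)) (by
    rintro r (⟨v, rfl⟩ | ⟨u, v, h, rfl⟩)
    · rw [map_pow, FreeGroup.lift_apply_of, ← MulOpposite.op_pow, togglePerm_pow]
      apply MulOpposite.unop_injective
      ext1 P
      simp [togglePerm]
    · simp only [map_mul, map_inv, FreeGroup.lift_apply_of]
      rw [mul_inv_eq_one, mul_inv_eq_iff_eq_mul]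
      apply MulOpposite.unop_injective
      ext1 P
      exact (toggle_comm h 1 1 P).symm)

/-- The value of a letter, i.e. of a vertex with a sign. -/
def letterVal (x : Γ.V × ℤˣ) : Γ.NGP := PresentedGroup.of x.1 ^ (x.2 : ℤ)

/-- The value of a word in the letters. -/
def wordVal (w : List (Γ.V × ℤˣ)) : Γ.NGP := (w.map letterVal).prod

@[simp] theorem wordVal_append (w y : List (Γ.V × ℤˣ)) :
    wordVal (w ++ y) = wordVal w * wordVal y := by simp [wordVal]

/-- The effect of a letter on configurations. -/
noncomputable def letterAct (P : Γ.Config) (x : Γ.V × ℤˣ) : Γ.Config :=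
  Γ.toggle x.1 ((x.2 : ℤ) : ZMod (Γ.num x.1)) P

theorem configHom_letterVal (x : Γ.V × ℤˣ) (P : Γ.Config) :
    (Γ.configHom (letterVal x)).unop P = letterAct P x := by
  obtain ⟨v, e⟩ := x
  have h : Γ.configHom (PresentedGroup.of v) = MulOpposite.op (togglePerm v 1) :=
    PresentedGroup.toGroup.of _
  rcases Int.units_eq_one_or e with rfl | rfl
  · simp [letterVal, letterAct, h, togglePerm]
  · simp only [letterVal, letterAct, Units.val_neg, Units.val_one, zpow_neg, zpow_one, map_inv, h,
      MulOpposite.unop_inv, MulOpposite.unop_op, Int.cast_neg, Int.cast_one]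
    rfl

theorem configHom_wordVal (w : List (Γ.V × ℤˣ)) (P : Γ.Config) :
    (Γ.configHom (wordVal w)).unop P = w.foldl letterAct P := by
  induction w generalizing P with
  | nil => simp [wordVal]
  | cons x w ih =>
    rw [List.foldl_cons, ← ih, ← configHom_letterVal]
    simp [wordVal]

/-- Since the action factors through the group, the final configuration is an invariant by which
words for the same element can be compared. -/
theorem foldl_letterAct_congr {w y : List (Γ.V × ℤˣ)} (h : wordVal w = wordVal y)
    (P : Γ.Config) : w.foldl letterAct P = y.foldl letterAct P := by
  rw [← configHom_wordVal, ← configHom_wordVal, h]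

/-! ### The total brightness -/

/-- The word length in `ZMod n`. -/
def cycLen {n : ℕ} (b : ZMod n) : ℕ := b.valMinAbs.natAbs

@[simp] theorem cycLen_zero {n : ℕ} : cycLen (0 : ZMod n) = 0 := by
  simp [cycLen]

/-- For even `n` this covers both `n / 2` and `-n / 2`, which are distinct exponents of equally
short powers; states therefore use integers rather than residues. -/
theorem cycLen_intCast {n : ℕ} [NeZero n] {a : ℤ} (h : 2 * a.natAbs ≤ n) :
    cycLen (a : ZMod n) = a.natAbs := by
  apply le_antisymm
  · exact ZMod.natAbs_min_of_le_div_two n _ _ (by simp) (ZMod.natAbs_valMinAbs_le _)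
  · exact ZMod.natAbs_min_of_le_div_two n _ _ (by simp) (by omega)

theorem cycLen_add_unit_le {n : ℕ} [NeZero n] (b : ZMod n) (e : ℤˣ) :
    cycLen (b + ((e : ℤ) : ZMod n)) ≤ cycLen b + 1 := by
  have h : (((b.valMinAbs + e : ℤ)) : ZMod n) = b + ((e : ℤ) : ZMod n) := by simp
  have h2 : cycLen (b + ((e : ℤ) : ZMod n)) ≤ (b.valMinAbs + e : ℤ).natAbs :=
    ZMod.natAbs_min_of_le_div_two n _ _ (by rw [h]; simp) (ZMod.natAbs_valMinAbs_le _)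
  have h3 := Int.natAbs_add_le b.valMinAbs e
  have h4 : (e : ℤ).natAbs = 1 := Int.units_natAbs e
  unfold cycLen at *
  omega

instance (v : Γ.V) : NeZero (Γ.num v) := ⟨by have := Γ.two_le_num v; omega⟩

/-- The brightness of a line of lamps. -/
def brightness {n : ℕ} (f : ℤ →₀ ZMod n) : ℕ := f.sum fun _ b => cycLen b

theorem brightness_add_single {n : ℕ} (f : ℤ →₀ ZMod n) (i : ℤ) (a : ZMod n) :
    brightness (f + Finsupp.single i a) + cycLen (f i) = brightness f + cycLen (f i + a) := by
  classical
  have key : ∀ g : ℤ →₀ ZMod n, brightness g = cycLen (g i) + (g.erase i).sum fun _ b => cycLen b :=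
    fun g => (Finsupp.add_sum_erase' g i (fun _ b => cycLen b) (by simp)).symm
  have h : (f + Finsupp.single i a).erase i = f.erase i := by simp
  rw [key f, key (f + _), h]
  simp
  ring

/-- The total brightness of a configuration. -/
def totalBrightness (P : Γ.Config) : ℕ := ∑ v, brightness (P.2 v)

theorem totalBrightness_toggle (v : Γ.V) (a : ZMod (Γ.num v)) (P : Γ.Config) :
    totalBrightness (Γ.toggle v a P) + cycLen (P.2 v (P.1 v)) =
      totalBrightness P + cycLen (P.2 v (P.1 v) + a) := by
  classical
  have h := brightness_add_single (P.2 v) (P.1 v) a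
  unfold totalBrightness
  rw [← Finset.add_sum_erase _ _ (Finset.mem_univ v), ← Finset.add_sum_erase _ _ (Finset.mem_univ v)]
  have h2 : ∑ x ∈ Finset.univ.erase v, brightness ((Γ.toggle v a P).2 x) =
      ∑ x ∈ Finset.univ.erase v, brightness (P.2 x) :=
    Finset.sum_congr rfl fun x hx => by
      simp [toggle, Function.update_of_ne (Finset.ne_of_mem_erase hx)]
  have h3 : (Γ.toggle v a P).2 v = P.2 v + Finsupp.single (P.1 v) a := by simp [toggle]
  rw [h2, h3]
  omega

theorem totalBrightness_foldl_le (w : List (Γ.V × ℤˣ)) (P : Γ.Config) :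
    totalBrightness (w.foldl letterAct P) ≤ totalBrightness P + w.length := by
  induction w generalizing P with
  | nil => simp
  | cons x w ih =>
    have h1 := ih (letterAct P x)
    have h2 := totalBrightness_toggle x.1 ((x.2 : ℤ) : ZMod (Γ.num x.1)) P
    have h3 := cycLen_add_unit_le (P.2 x.1 (P.1 x.1)) x.2
    rw [List.foldl_cons, List.length_cons]
    unfold letterAct at *
    omega

end NumberedGraph

namespace NumberedGraph

variable {Γ : NumberedGraph}

/-! ### The automaton recognizing geodesics -/

/-- A signed letter is allowed if it is positive, or its vertex is not an involution. -/
def Allowed (x : Γ.V × ℤˣ) : Prop := x.2 = 1 ∨ 2 < Γ.num x.1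

/-- A state assigns to every vertex the exponent of its syllable at the end of the word. -/
abbrev State (Γ : NumberedGraph) : Type := Γ.V → ℤ

/-- The letter lengthens the syllable of its vertex to a geodesic one. -/
def Extends (s : Γ.State) (x : Γ.V × ℤˣ) : Prop :=
  (s x.1 + x.2).natAbs = (s x.1).natAbs + 1 ∧ 2 * (s x.1 + x.2).natAbs ≤ Γ.num x.1

open Classical in
/-- The state after reading a letter. -/
noncomputable def step (s : Γ.State) (x : Γ.V × ℤˣ) : Γ.State := fun v =>
  if v = x.1 then s x.1 + x.2 else if Γ.graph.Adj x.1 v then s v else 0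

/-- Acceptance of a word of allowed letters from a given state. -/
def Accepts : Γ.State → List (Γ.V × ℤˣ) → Prop
  | _, [] => True
  | s, x :: w => (Allowed x ∧ Extends s x) ∧ Accepts (step s x) w

theorem Accepts.allowed {s : Γ.State} {w : List (Γ.V × ℤˣ)} (h : Accepts s w) :
    ∀ x ∈ w, Allowed x := by
  induction w generalizing s with
  | nil => simp
  | cons x w ih =>
    intro y hy
    rcases List.mem_cons.1 hy with rfl | hy
    · exact h.1.1
    · exact ih h.2 y hy

/-- The support of the state is a clique and all its exponents are geodesic. -/
structure State.Valid (s : Γ.State) : Prop where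
  adj : ∀ u v, s u ≠ 0 → s v ≠ 0 → u ≠ v → Γ.graph.Adj u v
  le : ∀ v, 2 * (s v).natAbs ≤ Γ.num v

theorem State.valid_zero : State.Valid (0 : Γ.State) := ⟨by simp, by simp⟩

/-- The new support consists of the vertex read and those of its neighbours that were in the old
support, so it is again a clique. -/
theorem State.Valid.step {s : Γ.State} (hs : s.Valid) {x : Γ.V × ℤˣ} (hx : Extends s x) :
    (step s x).Valid := by
  constructor
  · intro u v hu hv huv
    simp only [NumberedGraph.step] at hu hv
    by_cases h1 : u = x.1
    · subst h1
      by_contra h2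
      simp [Ne.symm huv, h2] at hv
    · by_cases h2 : v = x.1
      · subst h2
        by_contra h3
        simp [huv, Γ.graph.adj_comm, h3] at hu
      · simp only [h1, h2, if_false] at hu hv
        exact hs.adj u v (fun h => hu (by simp [h])) (fun h => hv (by simp [h])) huv
  · intro v
    simp only [NumberedGraph.step]
    split_ifs with h1
    · subst h1; exact hx.2
    · exact hs.le v
    · simp

/-! ### Accepted words are geodesic -/

/-- The configuration is in accordance with the state: the lamps under the cursors show the
exponents, and there is no light ahead of the cursors. -/
structure Config.Fits (P : Γ.Config) (s : Γ.State) : Prop where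
  cursor : ∀ v, P.2 v (P.1 v) = ((s v : ℤ) : ZMod (Γ.num v))
  ahead : ∀ v i, P.1 v < i → P.2 v i = 0

theorem lit_intCast {n : ℕ} (hn : 2 ≤ n) {a : ℤ} (h : 2 * a.natAbs ≤ n) :
    lit (a : ZMod n) = if a = 0 then 0 else 1 := by
  unfold lit
  congr 1
  rw [ZMod.intCast_zmod_eq_zero_iff_dvd, eq_iff_iff]
  constructor
  · intro h1
    by_contra h2
    have := Int.natAbs_dvd_natAbs.2 h1
    have := Nat.le_of_dvd (by omega) this
    simp at this
    omega
  · rintro rfl; simp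

theorem Config.Fits.letterAct {P : Γ.Config} {s : Γ.State} (h : P.Fits s) (hs : s.Valid)
    {x : Γ.V × ℤˣ} (hx : Extends s x) : Config.Fits (letterAct P x) (step s x) := by
  classical
  obtain ⟨u, e⟩ := x
  obtain ⟨hx1, hx2⟩ := hx
  simp only at hx1 hx2
  have hn := Γ.two_le_num u
  have hl1 : lit (P.2 u (P.1 u)) = if s u = 0 then 0 else 1 := by
    rw [h.cursor, lit_intCast hn (hs.le u)]
  have hl2 : lit (P.2 u (P.1 u) + ((e : ℤ) : ZMod (Γ.num u))) = 1 := by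
    rw [h.cursor, ← Int.cast_add, lit_intCast hn hx2, if_neg (by omega)]
  constructor
  · intro v
    by_cases hv : v = u
    · subst hv
      simp [NumberedGraph.letterAct, toggle, NumberedGraph.step, h.cursor]
    by_cases ha : Γ.graph.Adj u v
    · simp [NumberedGraph.letterAct, toggle, NumberedGraph.step, hv, ha, h.cursor]
    · simp only [NumberedGraph.letterAct, toggle, NumberedGraph.step, hv, ha, or_self, if_false,
        Function.update_of_ne hv, hl1, hl2, Int.cast_zero]
      -- If the lamp of `u` was dark, it is switched on and the cursor of `v` advances to a dark
      -- lamp. Otherwise the cursor stays, and its lamp is already dark because the support of `s`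
      -- is a clique.
      by_cases hu : s u = 0
      · simp [hu, h.ahead]
      · have hv0 : s v = 0 := by
          by_contra hv0
          exact ha (hs.adj u v hu hv0 (Ne.symm hv))
        simp [hu, h.cursor, hv0]
  · intro v i hi
    by_cases hv : v = u
    · subst hv
      simp only [NumberedGraph.letterAct, toggle, true_or, if_true] at hi
      simp [NumberedGraph.letterAct, toggle, h.ahead v i hi, Finsupp.single_eq_of_ne hi.ne']
    by_cases ha : Γ.graph.Adj u v
    · simp only [NumberedGraph.letterAct, toggle, ha, or_true, if_true] at hi
      simpa [NumberedGraph.letterAct, toggle, hv] using h.ahead v i hi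
    · simp only [NumberedGraph.letterAct, toggle, hv, ha, or_self, if_false, hl1, hl2] at hi
      have : P.1 v < i := by split_ifs at hi <;> omega
      simpa [NumberedGraph.letterAct, toggle, hv] using h.ahead v i this

theorem totalBrightness_of_accepts {P : Γ.Config} {s : Γ.State} (h : P.Fits s) (hs : s.Valid)
    {w : List (Γ.V × ℤˣ)} (hw : Accepts s w) :
    totalBrightness (w.foldl letterAct P) = totalBrightness P + w.length := by
  induction w generalizing P s with
  | nil => simp
  | cons x w ih =>
    have hx := hw.1.2
    rw [List.foldl_cons, ih (h.letterAct hs hx) (hs.step hx) hw.2, List.length_cons]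
    have h1 := totalBrightness_toggle x.1 ((x.2 : ℤ) : ZMod (Γ.num x.1)) P
    rw [h.cursor, ← Int.cast_add, cycLen_intCast (hs.le _), cycLen_intCast hx.2, hx.1] at h1
    unfold letterAct
    omega

/-- Starting with all lamps dark, the final brightness equals the length of `w` and is at most the
length of `y`. -/
theorem Accepts.length_le {w y : List (Γ.V × ℤˣ)} (hw : Accepts 0 w)
    (h : wordVal y = wordVal w) : w.length ≤ y.length := by
  have hfit : Config.Fits (0 : Γ.Config) 0 := ⟨by simp, by simp⟩
  have h1 := totalBrightness_of_accepts hfit State.valid_zero hw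
  have h2 := totalBrightness_foldl_le y (0 : Γ.Config)
  rw [foldl_letterAct_congr h] at h2
  omega

/-! ### Geodesic words are accepted -/

theorem of_pow_num (v : Γ.V) : (PresentedGroup.of v : Γ.NGP) ^ Γ.num v = 1 := by
  have : PresentedGroup.mk Γ.relators (FreeGroup.of v ^ Γ.num v) = 1 :=
    PresentedGroup.one_of_mem (Or.inl ⟨v, rfl⟩)
  rwa [map_pow] at this

theorem of_commute {u v : Γ.V} (h : Γ.graph.Adj u v) :
    Commute (PresentedGroup.of u : Γ.NGP) (PresentedGroup.of v) := by
  have : PresentedGroup.mk Γ.relators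
      (FreeGroup.of u * FreeGroup.of v * (FreeGroup.of u)⁻¹ * (FreeGroup.of v)⁻¹) = 1 :=
    PresentedGroup.one_of_mem (Or.inr ⟨u, v, h, rfl⟩)
  simp only [map_mul, map_inv] at this
  rwa [mul_inv_eq_one, mul_inv_eq_iff_eq_mul] at this

theorem exists_wordVal_eq_zpow (v : Γ.V) (a : ℤ) :
    ∃ w : List (Γ.V × ℤˣ), w.length = a.natAbs ∧ wordVal w = PresentedGroup.of v ^ a := by
  obtain ⟨n, rfl | rfl⟩ := a.eq_nat_or_neg
  · exact ⟨List.replicate n (v, 1), by simp, by simp [wordVal, letterVal]⟩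
  · exact ⟨List.replicate n (v, -1), by simp, by simp [wordVal, letterVal]⟩

/-- A power that is not geodesic in the cyclic group has a shorter expression. -/
theorem exists_shorter_zpow (v : Γ.V) (a : ℤ) (h : Γ.num v < 2 * a.natAbs) :
    ∃ b : ℤ, b.natAbs < a.natAbs ∧
      (PresentedGroup.of v : Γ.NGP) ^ b = PresentedGroup.of v ^ a := by
  have hn := Γ.two_le_num v
  have hz : (PresentedGroup.of v : Γ.NGP) ^ (Γ.num v : ℤ) = 1 := by
    rw [zpow_natCast, of_pow_num]
  rcases le_total 0 a with ha | ha
  · exact ⟨a - Γ.num v, by omega, by rw [zpow_sub, hz]; simp⟩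
  · exact ⟨a + Γ.num v, by omega, by rw [zpow_add, hz]; simp⟩

/-- Every syllable recorded by the state can be moved to the end of the word. -/
def Tracks (x : List (Γ.V × ℤˣ)) (s : Γ.State) : Prop :=
  ∀ u, ∃ y : List (Γ.V × ℤˣ), y.length + (s u).natAbs = x.length ∧
    wordVal x = wordVal y * PresentedGroup.of u ^ s u

/-- A syllable of the same vertex absorbs the new letter, a syllable of an adjacent vertex commutes
past it, and every other exponent is reset to zero, where nothing needs to be moved. -/
theorem Tracks.step {w : List (Γ.V × ℤˣ)} {s : Γ.State} (h : Tracks w s) {x : Γ.V × ℤˣ}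
    (hx : Extends s x) : Tracks (w ++ [x]) (step s x) := by
  intro v
  have hs : wordVal [x] = letterVal x := by simp [wordVal]
  simp only [NumberedGraph.step]
  split_ifs with h1 h2
  · subst h1
    obtain ⟨y, hy1, hy2⟩ := h x.1
    refine ⟨y, ?_, ?_⟩
    · rw [hx.1]; simp; omega
    · rw [wordVal_append, hy2, zpow_add, hs, mul_assoc]; rfl
  · obtain ⟨y, hy1, hy2⟩ := h v
    refine ⟨y ++ [x], ?_, ?_⟩
    · simp; omega
    · rw [wordVal_append, wordVal_append, hy2, hs, mul_assoc, mul_assoc]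
      congr 1
      exact ((of_commute h2.symm).zpow_zpow _ _).eq
  · exact ⟨w ++ [x], by simp, by simp⟩

/-- At the first rejected letter, the syllable of its vertex is moved to the end and merged with the
letter; the resulting power has an expression shorter than the syllable followed by the letter. -/
theorem exists_shorter_of_not_accepts {s : Γ.State} {x w : List (Γ.V × ℤˣ)} (h : Tracks x s)
    (hw : ∀ a ∈ w, Allowed a) (hn : ¬ Accepts s w) :
    ∃ y : List (Γ.V × ℤˣ), y.length < x.length + w.length ∧ wordVal y = wordVal (x ++ w) := by
  induction w generalizing x s with
  | nil => exact absurd trivial hn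
  | cons a w ih =>
    by_cases ha : Extends s a
    · obtain ⟨y, hy1, hy2⟩ := ih (h.step ha) (fun b hb => hw b (List.mem_cons_of_mem _ hb))
        (fun hw' => hn ⟨⟨hw a List.mem_cons_self, ha⟩, hw'⟩)
      refine ⟨y, ?_, ?_⟩
      · simp at hy1 ⊢; omega
      · rw [hy2]; simp
    · obtain ⟨y, hy1, hy2⟩ := h a.1
      obtain ⟨b, hb1, hb2⟩ : ∃ b : ℤ, b.natAbs < (s a.1).natAbs + 1 ∧
          (PresentedGroup.of a.1 : Γ.NGP) ^ b = PresentedGroup.of a.1 ^ (s a.1 + a.2) := by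
        have h1 := Int.natAbs_add_le (s a.1) a.2
        have h2 : (a.2 : ℤ).natAbs = 1 := Int.units_natAbs a.2
        -- Either the exponent has become longer than half the order and can be reduced modulo it,
        -- or the letter cancels.
        by_cases h3 : (s a.1 + a.2).natAbs = (s a.1).natAbs + 1
        · have h4 : Γ.num a.1 < 2 * (s a.1 + a.2).natAbs := by
            by_contra h4
            exact ha ⟨h3, by omega⟩
          obtain ⟨b, hb1, hb2⟩ := exists_shorter_zpow a.1 _ h4
          exact ⟨b, by omega, hb2⟩
        · exact ⟨_, by omega, rfl⟩
      obtain ⟨z, hz1, hz2⟩ := exists_wordVal_eq_zpow a.1 b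
      refine ⟨y ++ z ++ w, ?_, ?_⟩
      · simp; omega
      · have hs : wordVal (x ++ a :: w) = wordVal x * (letterVal a * wordVal w) := by
          simp [wordVal]
        rw [hs, hy2, wordVal_append, wordVal_append, hz2, hb2, zpow_add]
        simp [letterVal, mul_assoc]

theorem accepts_iff {w : List (Γ.V × ℤˣ)} :
    Accepts 0 w ↔ (∀ a ∈ w, Allowed a) ∧
      ∀ y : List (Γ.V × ℤˣ), wordVal y = wordVal w → w.length ≤ y.length := by
  refine ⟨fun h => ⟨h.allowed, fun y hy => h.length_le hy⟩, fun ⟨h1, h2⟩ => ?_⟩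
  by_contra hn
  obtain ⟨y, hy1, hy2⟩ := exists_shorter_of_not_accepts (s := 0) (x := [])
    (fun u => ⟨[], by simp [wordVal]⟩) h1 hn
  have := h2 y hy2
  simp at hy1
  omega

end NumberedGraph

namespace NumberedGraph

variable {Γ : NumberedGraph}

/-! ### Homomorphisms to cyclic groups -/

open Classical in
/-- The homomorphism to a cyclic group that sends one vertex to `a` and kills the others. -/
noncomputable def toCyclic (v : Γ.V) (m : ℕ) (a : ZMod m) (h : (Γ.num v : ZMod m) * a = 0) :
    Γ.NGP →* Multiplicative (ZMod m) :=
  PresentedGroup.toGroup (f := fun u => Multiplicative.ofAdd (if u = v then a else 0)) (by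
    rintro r (⟨u, rfl⟩ | ⟨u, w, -, rfl⟩)
    · rw [map_pow, FreeGroup.lift_apply_of, ← ofAdd_nsmul]
      by_cases hu : u = v
      · subst hu; simp [nsmul_eq_mul, h]
      · simp [hu]
    · simp only [map_mul, map_inv]
      rw [mul_inv_eq_one, mul_inv_eq_iff_eq_mul, mul_comm])

open Classical in
theorem toCyclic_of (v u : Γ.V) (m : ℕ) (a : ZMod m) (h : (Γ.num v : ZMod m) * a = 0) :
    toCyclic v m a h (PresentedGroup.of u) = Multiplicative.ofAdd (if u = v then a else 0) :=
  PresentedGroup.toGroup.of _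

/-- The cyclic quotient at `u` separates `u` from all other vertices, and from its inverse unless
its order is two, in which case only the positive letter is allowed. -/
theorem letterVal_injOn : Set.InjOn (letterVal (Γ := Γ)) {x | Allowed x} := by
  classical
  rintro ⟨u, e⟩ hu ⟨v, f⟩ hv h
  have hn := Γ.two_le_num u
  have h1 := congrArg (toCyclic u (Γ.num u) 1 (by simp)) h
  simp only [letterVal, map_zpow, toCyclic_of, ← ofAdd_zsmul, EmbeddingLike.apply_eq_iff_eq] at h1
  by_cases huv : v = u
  · subst huv
    simp only [Allowed, Set.mem_ofPred_eq] at hu hv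
    simp only [if_true, zsmul_eq_mul, mul_one] at h1
    rw [ZMod.intCast_eq_intCast_iff_dvd_sub] at h1
    rcases Int.units_eq_one_or e with rfl | rfl <;> rcases Int.units_eq_one_or f with rfl | rfl
    · rfl
    · exfalso
      have h2 : 2 < Γ.num v := by simpa using hv
      have h3 := Int.natAbs_dvd_natAbs.2 h1
      simp at h3
      have := Nat.le_of_dvd (by norm_num) h3
      omega
    · exfalso
      have h2 : 2 < Γ.num v := by simpa using hu
      have h3 := Int.natAbs_dvd_natAbs.2 h1
      simp at h3
      have := Nat.le_of_dvd (by norm_num) h3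
      omega
    · rfl
  · exfalso
    simp only [if_true, huv, if_false, zsmul_eq_mul, mul_one, mul_zero] at h1
    rw [ZMod.intCast_zmod_eq_zero_iff_dvd] at h1
    have h3 := Int.natAbs_dvd_natAbs.2 h1
    rw [Int.units_natAbs] at h3
    have := Nat.le_of_dvd (by norm_num) h3
    simp at this
    omega

/-! ### The geodesic growth as a count of accepted words -/

theorem letterVal_mem (x : Γ.V × ℤˣ) : letterVal x ∈ Γ.stdGen := by
  obtain ⟨v, e⟩ := x
  refine ⟨v, ?_⟩
  rcases Int.units_eq_one_or e with rfl | rfl <;> simp [letterVal]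

/-- A letter as an element of the standard generating set. -/
def letterGen (x : Γ.V × ℤˣ) : Γ.stdGen := ⟨letterVal x, letterVal_mem x⟩

theorem exists_allowed_letterGen_eq (g : Γ.stdGen) :
    ∃ x : Γ.V × ℤˣ, Allowed x ∧ letterGen x = g := by
  obtain ⟨g, v, rfl | rfl⟩ := g
  · exact ⟨(v, 1), Or.inl rfl, Subtype.ext (by simp [letterGen, letterVal])⟩
  · by_cases h : 2 < Γ.num v
    · exact ⟨(v, -1), Or.inr h, Subtype.ext (by simp [letterGen, letterVal])⟩
    · refine ⟨(v, 1), Or.inl rfl, Subtype.ext ?_⟩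
      have h2 : Γ.num v = 2 := le_antisymm (by omega) (Γ.two_le_num v)
      have h3 := of_pow_num v
      rw [h2, pow_two] at h3
      simpa [letterGen, letterVal] using eq_inv_of_mul_eq_one_left h3

theorem evalWord_map_letterGen (w : List (Γ.V × ℤˣ)) :
    evalWord Γ.stdGen (w.map letterGen) = wordVal w := by
  simp [evalWord, wordVal, Function.comp_def, letterGen]

theorem map_letterGen_injOn :
    Set.InjOn (List.map (letterGen (Γ := Γ))) {w | ∀ x ∈ w, Allowed x} := by
  intro w hw
  induction w with
  | nil => intro y _ h; simpa using h.symm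
  | cons a w ih =>
    intro y hy h
    cases y with
    | nil => simp at h
    | cons b y =>
      simp only [List.map_cons, List.cons.injEq] at h
      simp only [Set.mem_ofPred_eq, List.mem_cons, forall_eq_or_imp] at hw hy
      rw [letterVal_injOn hw.1 hy.1 (congrArg Subtype.val h.1), ih hw.2 hy.2 h.2]

theorem exists_map_letterGen_eq (w : List Γ.stdGen) :
    ∃ y : List (Γ.V × ℤˣ), (∀ x ∈ y, Allowed x) ∧ y.map letterGen = w := by
  choose f hf hf' using exists_allowed_letterGen_eq (Γ := Γ)
  refine ⟨w.map f, ?_, ?_⟩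
  · simp only [List.mem_map]
    rintro x ⟨g, -, rfl⟩
    exact hf g
  · simp [Function.comp_def, hf']

theorem map_letterGen_mem_geodesicLanguage {w : List (Γ.V × ℤˣ)} (hw : ∀ x ∈ w, Allowed x) :
    w.map letterGen ∈ geodesicLanguage Γ.stdGen ↔ Accepts 0 w := by
  rw [accepts_iff]
  constructor
  · intro h
    refine ⟨hw, fun y hy => ?_⟩
    have := h (y.map letterGen) (by rw [evalWord_map_letterGen, evalWord_map_letterGen, hy])
    simpa using this
  · rintro ⟨-, h⟩ y hy
    obtain ⟨y, -, rfl⟩ := exists_map_letterGen_eq y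
    rw [evalWord_map_letterGen, evalWord_map_letterGen] at hy
    simpa using h y hy

/-- The accepted words of a given length. -/
def acceptedWords (m : ℕ) (s : Γ.State) : Set (List (Γ.V × ℤˣ)) :=
  {w | w.length = m ∧ Accepts s w}

/-- Words of allowed letters correspond bijectively to words over the standard generating set, in
which an involution and its inverse are a single element. -/
theorem coeff_geodesicGrowth (Γ : NumberedGraph) (m : ℕ) :
    PowerSeries.coeff m Γ.geodesicGrowth = ((acceptedWords m (0 : Γ.State)).ncard : ℤ) := by
  rw [geodesicGrowth, Language.growthSeries, PowerSeries.coeff_mk,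
    ← Set.InjOn.ncard_image (f := List.map (letterGen (Γ := Γ))) (s := acceptedWords m 0)
      (fun w hw y hy => map_letterGen_injOn hw.2.allowed hy.2.allowed)]
  congr 2
  ext w
  constructor
  · rintro ⟨hw, hm⟩
    obtain ⟨y, hy, rfl⟩ := exists_map_letterGen_eq w
    exact ⟨y, ⟨by simpa using hm, (map_letterGen_mem_geodesicLanguage hy).1 hw⟩, rfl⟩
  · rintro ⟨y, ⟨hm, hy⟩, rfl⟩
    exact ⟨(map_letterGen_mem_geodesicLanguage hy.allowed).2 hy, by simpa using hm⟩

open Classical in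
theorem ncard_acceptedWords_succ (m : ℕ) (s : Γ.State) :
    (acceptedWords (m + 1) s).ncard = ∑ v, ∑ e : ℤˣ,
      if Allowed (v, e) ∧ Extends s (v, e) then (acceptedWords m (step s (v, e))).ncard else 0 := by
  have hfin : ∀ (m : ℕ) (s : Γ.State), (acceptedWords m s).Finite := fun m s =>
    (List.finite_length_eq _ m).subset fun w hw => hw.1
  have h : acceptedWords (m + 1) s = ⋃ x : Γ.V × ℤˣ,
      if Allowed x ∧ Extends s x then (List.cons x) '' acceptedWords m (step s x) else ∅ := by
    ext w
    simp only [Set.mem_iUnion, Set.mem_ite_empty_right,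
      Set.mem_image]
    constructor
    · rintro ⟨hl, hw⟩
      cases w with
      | nil => simp at hl
      | cons x w => exact ⟨x, hw.1, w, ⟨by simpa using hl, hw.2⟩, rfl⟩
    · rintro ⟨x, hx, y, ⟨hl, hy⟩, rfl⟩
      exact ⟨by simpa using hl, hx, hy⟩
  have hfin' : ∀ x, (if Allowed x ∧ Extends s x then
      (List.cons x) '' acceptedWords m (step s x) else ∅).Finite := by
    intro x
    split_ifs
    · exact (hfin _ _).image _
    · exact Set.finite_empty
  rw [h, ← Fintype.sum_prod_type' (f := fun v e => if Allowed (v, e) ∧ Extends s (v, e) then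
    (acceptedWords m (step s (v, e))).ncard else 0),
    Set.ncard_iUnion_of_finite hfin', finsum_eq_sum_of_fintype]
  · refine Finset.sum_congr rfl fun x _ => ?_
    split_ifs
    · exact Set.ncard_image_of_injective _ List.cons_injective
    · exact Set.ncard_empty _
  · intro x y hxy
    rw [Function.onFun, Set.disjoint_left]
    simp only [Set.mem_ite_empty_right, Set.mem_image, not_and]
    rintro w ⟨-, a, -, rfl⟩ -
    rintro ⟨b, -, hb⟩
    exact hxy (List.cons.inj hb).1.symm

end NumberedGraph

namespace NumberedGraph

/-! ### Coverings of triangle-free numbered graphs -/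

/-- A `k`-fold covering of numbered graphs. -/
structure IsCovering (k : ℕ) {Γ Δ : NumberedGraph} (p : Γ.V → Δ.V) : Prop where
  num : ∀ v, Δ.num (p v) = Γ.num v
  adj : ∀ u v, Γ.graph.Adj u v → Δ.graph.Adj (p u) (p v)
  inj : ∀ v u u', Γ.graph.Adj v u → Γ.graph.Adj v u' → p u = p u' → u = u'
  lift : ∀ v c, Δ.graph.Adj (p v) c → ∃ u, Γ.graph.Adj v u ∧ p u = c
  card_fiber : ∀ c, {v | p v = c}.ncard = k

/-- The graph has no triangles. -/
def TriangleFree (Γ : NumberedGraph) : Prop :=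
  ∀ a b c, Γ.graph.Adj a b → Γ.graph.Adj a c → ¬ Γ.graph.Adj b c

variable {Γ Δ : NumberedGraph} {k : ℕ} {p : Γ.V → Δ.V}

/-- Over a triangle-free graph, the neighbourhood of every clique has a section. -/
theorem IsCovering.exists_section (hp : IsCovering k p) (hk : 0 < k) (hΔ : Δ.TriangleFree)
    {σ : Set Γ.V} (hσ : Γ.graph.IsClique σ) :
    ∃ q : Δ.V → Γ.V, (∀ c, p (q c) = c) ∧ (∀ v ∈ σ, q (p v) = v) ∧
      ∀ v ∈ σ, ∀ c, Δ.graph.Adj (p v) c → Γ.graph.Adj v (q c) := by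
  have main : ∀ c, ∃ u, p u = c ∧ (∀ v ∈ σ, p v = c → u = v) ∧
      ∀ v ∈ σ, Δ.graph.Adj (p v) c → Γ.graph.Adj v u := by
    intro c
    by_cases h1 : ∃ v ∈ σ, p v = c
    · obtain ⟨v, hv, rfl⟩ := h1
      have huniq : ∀ w ∈ σ, p w = p v → v = w := fun w hw hwv => by
        by_contra hne
        exact (hp.adj _ _ (hσ hv hw hne)).ne hwv.symm
      refine ⟨v, rfl, huniq, fun w hw hwv => hσ hw hv ?_⟩
      rintro rfl
      exact hwv.ne rfl
    · by_cases h2 : ∃ v ∈ σ, Δ.graph.Adj (p v) c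
      · obtain ⟨v, hv, hvc⟩ := h2
        obtain ⟨u, hu, rfl⟩ := hp.lift v c hvc
        refine ⟨u, rfl, fun w hw hwu => absurd ⟨w, hw, hwu⟩ h1, fun w hw hwu => ?_⟩
        by_cases hwv : v = w
        · exact hwv ▸ hu
        -- Two clique vertices whose images are both adjacent to `c` would span a triangle with `c`
        -- in the base.
        · exact absurd hwu (hΔ _ _ _ (hp.adj _ _ (hσ hv hw hwv)) hvc)
      · have h3 : {v | p v = c}.Nonempty := by
          rw [← Set.ncard_pos, hp.card_fiber]
          exact hk
        obtain ⟨u, hu⟩ := h3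
        exact ⟨u, hu, fun w hw hwu => absurd ⟨w, hw, hwu⟩ h1,
          fun w hw hwu => absurd ⟨w, hw, hwu⟩ h2⟩
  choose q hq1 hq2 hq3 using main
  exact ⟨q, hq1, fun v hv => hq2 _ v hv rfl, fun v hv c => hq3 c v hv⟩

/-- The state `t` is the image of the valid state `s`. -/
def Projects (p : Γ.V → Δ.V) (s : Γ.State) (t : Δ.State) : Prop :=
  s.Valid ∧ ∃ q : Δ.V → Γ.V, (∀ c, p (q c) = c) ∧ (∀ v, s v ≠ 0 → q (p v) = v) ∧ ∀ c, t c = s (q c)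

/-- The given section can be replaced by one that also respects adjacency to the support: `t` is
unchanged, as any two sections through the support differ only where `s` vanishes. -/
theorem Projects.exists_section {s : Γ.State} {t : Δ.State} (h : Projects p s t)
    (hp : IsCovering k p) (hk : 0 < k) (hΔ : Δ.TriangleFree) :
    ∃ q : Δ.V → Γ.V, (∀ c, p (q c) = c) ∧ (∀ v, s v ≠ 0 → q (p v) = v) ∧ (∀ c, t c = s (q c)) ∧
      ∀ v, s v ≠ 0 → ∀ c, Δ.graph.Adj (p v) c → Γ.graph.Adj v (q c) := by
  obtain ⟨hs, q, hq1, hq2, hq3⟩ := h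
  obtain ⟨r, hr1, hr2, hr3⟩ := hp.exists_section hk hΔ (σ := {v | s v ≠ 0})
    (fun u hu v hv huv => hs.adj u v hu hv huv)
  refine ⟨r, hr1, hr2, fun c => ?_, hr3⟩
  rw [hq3]
  by_cases h1 : s (q c) = 0
  · by_contra h2
    rw [h1] at h2
    have := hq2 (r c) (Ne.symm h2)
    rw [hr1] at this
    rw [this] at h1
    exact h2 h1.symm
  · have := hr2 (q c) h1
    rw [hq1] at this
    rw [this]

/-- The same section serves after the step, because on the support of `s` it preserves and reflects
adjacency to the vertex being read. -/
theorem projects_step {s : Γ.State} {t : Δ.State} {q : Δ.V → Γ.V} (hp : IsCovering k p)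
    (hs : s.Valid) (hq1 : ∀ c, p (q c) = c) (hq2 : ∀ v, s v ≠ 0 → q (p v) = v)
    (hq3 : ∀ c, t c = s (q c))
    (hq4 : ∀ v, s v ≠ 0 → ∀ c, Δ.graph.Adj (p v) c → Γ.graph.Adj v (q c))
    {c : Δ.V} {e : ℤˣ} (hx : Extends s (q c, e)) :
    Projects p (step s (q c, e)) (step t (c, e)) := by
  refine ⟨hs.step hx, q, hq1, fun v hv => ?_, fun d => ?_⟩
  · simp only [step] at hv
    by_cases h1 : v = q c
    · subst h1; rw [hq1]
    · refine hq2 v fun h => hv ?_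
      simp [h1, h]
  · have hinj : q d = q c ↔ d = c := by
      refine ⟨fun h => ?_, fun h => by rw [h]⟩
      rw [← hq1 d, h, hq1]
    by_cases h1 : d = c
    · simp [step, h1, hq3]
    · have h1' : q d ≠ q c := fun h => h1 (hinj.1 h)
      simp only [step, if_neg h1, if_neg h1', hq3]
      by_cases h2 : s (q d) = 0
      · simp [h2]
      · congr 1
        rw [eq_iff_iff]
        constructor
        · intro h3
          refine (hq4 (q d) h2 c ?_).symm
          rw [hq1]
          exact h3.symm
        · intro h3
          simpa only [hq1] using hp.adj _ _ h3

theorem IsCovering.allowed_iff (hp : IsCovering k p) (v : Γ.V) (e : ℤˣ) :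
    Allowed (v, e) ↔ Allowed (p v, e) := by
  simp [Allowed, hp.num]

open Classical in
/-- The number of accepted words of a given length in a `k`-fold covering, computed from the
projected state. -/
noncomputable def coverCount (Δ : NumberedGraph) (k : ℕ) : ℕ → Δ.State → ℕ
  | 0, _ => 1
  | m + 1, t => ∑ c, ∑ e : ℤˣ,
      ((if Allowed (c, e) ∧ Extends t (c, e) then coverCount Δ k m (step t (c, e)) else 0) +
        (k - 1) * if Allowed (c, e) ∧ Extends 0 (c, e) then coverCount Δ k m (step 0 (c, e)) else 0)

theorem ncard_acceptedWords_zero (s : Γ.State) : (acceptedWords 0 s).ncard = 1 := by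
  have : acceptedWords 0 s = {[]} := by
    ext w
    constructor
    · rintro ⟨h, -⟩
      simpa using h
    · rintro rfl
      exact ⟨rfl, trivial⟩
  rw [this, Set.ncard_singleton]

theorem projects_zero (hp : IsCovering k p) (hk : 0 < k) (hΔ : Δ.TriangleFree) :
    Projects p (0 : Γ.State) (0 : Δ.State) := by
  obtain ⟨q, hq, -, -⟩ := hp.exists_section hk hΔ (σ := ∅) (by simp)
  exact ⟨State.valid_zero, q, hq, by simp, by simp⟩

/-- No recorded syllable commutes with the letter, so reading it erases the whole memory. -/
theorem step_eq_step_zero {s : Γ.State} {v : Γ.V} (h0 : s v = 0)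
    (h : ∀ u, s u ≠ 0 → ¬ Γ.graph.Adj v u) (e : ℤˣ) : step s (v, e) = step 0 (v, e) := by
  funext u
  simp only [step, h0]
  split_ifs with h1 h2
  · simp
  · by_contra h3
    exact h u h3 h2
  · rfl

/-- Words accepted from a state of a covering are counted by the projected state. -/
theorem ncard_acceptedWords_eq_coverCount (hp : IsCovering k p) (hk : 0 < k)
    (hΔ : Δ.TriangleFree) (m : ℕ) {s : Γ.State} {t : Δ.State} (h : Projects p s t) :
    (acceptedWords m s).ncard = coverCount Δ k m t := by
  classical
  induction m generalizing s t with
  | zero => rw [ncard_acceptedWords_zero, coverCount]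
  | succ m ih =>
    obtain ⟨q, hq1, hq2, hq3, hq4⟩ := h.exists_section hp hk hΔ
    have hs := h.1
    rw [ncard_acceptedWords_succ, coverCount, ← Finset.sum_fiberwise _ p]
    refine Finset.sum_congr rfl fun c _ => ?_
    rw [Finset.sum_comm]
    refine Finset.sum_congr rfl fun e _ => ?_
    have hmem : q c ∈ Finset.univ.filter fun v => p v = c := by simp [hq1]
    have hcard : ((Finset.univ.filter fun v => p v = c).erase (q c)).card = k - 1 := by
      rw [Finset.card_erase_of_mem hmem, ← hp.card_fiber c, ← Set.ncard_coe_finset]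
      simp
    -- The lift `q c` yields the term of the projected state `t`; the remaining `k - 1` lifts of `c`
    -- yield the terms of the zero state.
    rw [← Finset.add_sum_erase _ _ hmem]
    congr 1
    · have h1 : Allowed (q c, e) ↔ Allowed (c, e) := by rw [hp.allowed_iff, hq1]
      have h2 : Extends s (q c, e) ↔ Extends t (c, e) := by
        simp only [Extends, hq3, ← hp.num, hq1]
      rw [h1, ← h2]
      split_ifs with h3
      · exact ih (projects_step hp hs hq1 hq2 hq3 hq4 h3.2)
      · rfl
    · rw [← hcard, ← smul_eq_mul, ← Finset.sum_const]
      refine Finset.sum_congr rfl fun v hv => ?_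
      obtain ⟨hne, hv⟩ := Finset.mem_erase.1 hv
      obtain rfl : p v = c := (Finset.mem_filter.1 hv).2
      have h0 : s v = 0 := by
        by_contra h0
        exact hne (hq2 v h0).symm
      -- If `u` in the support were adjacent to `v`, then `v` and `q (p v)` would be two neighbours
      -- of `u` over the same vertex, against local injectivity.
      have hfar : ∀ u, s u ≠ 0 → ¬ Γ.graph.Adj v u := fun u hu hvu => by
        have hup := (hp.adj _ _ hvu).symm
        exact hne (hp.inj u v _ hvu.symm (hq4 u hu _ hup) (hq1 _).symm)
      have h2 : Extends s (v, e) ↔ Extends (0 : Δ.State) (p v, e) := by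
        simp only [Extends, h0, hp.num, Pi.zero_apply]
      have h2' : Extends s (v, e) ↔ Extends (0 : Γ.State) (v, e) := by
        simp only [Extends, h0, Pi.zero_apply]
      rw [hp.allowed_iff, ← h2, step_eq_step_zero h0 hfar]
      split_ifs with h3
      · refine ih ?_
        -- The section `q` misses `v`, so the step from the zero state is projected along another
        -- section, one through `v`.
        obtain ⟨r, hr1, hr2, -⟩ := hp.exists_section hk hΔ (σ := {v}) (by simp)
        have hrv : r (p v) = v := hr2 v rfl
        have := projects_step (s := 0) (t := 0) hp State.valid_zero hr1 (by simp) (by simp)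
          (by simp) (c := p v) (e := e) (by rw [hrv]; exact h2'.1 h3.2)
        rwa [hrv] at this
      · rfl

/-- The geodesic growth of a `k`-fold covering of a triangle-free numbered graph depends only on
`k` and the graph. -/
theorem geodesicGrowth_eq_of_isCovering {Γ' : NumberedGraph} {p' : Γ'.V → Δ.V} (hk : 0 < k)
    (hΔ : Δ.TriangleFree) (hp : IsCovering k p) (hp' : IsCovering k p') :
    Γ.geodesicGrowth = Γ'.geodesicGrowth := by
  ext m
  rw [coeff_geodesicGrowth, coeff_geodesicGrowth,
    ncard_acceptedWords_eq_coverCount hp hk hΔ m (projects_zero hp hk hΔ),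
    ncard_acceptedWords_eq_coverCount hp' hk hΔ m (projects_zero hp' hk hΔ)]

/-! ### Link-regularity of coverings -/

theorem mem_link {Γ : NumberedGraph} {σ : Finset Γ.V} (hσ : Γ.graph.IsClique (σ : Set Γ.V))
    {v : Γ.V} : v ∈ Γ.link σ ↔ ∀ u ∈ σ, Γ.graph.Adj u v := by
  simp only [link, Finset.mem_filter, Finset.mem_univ, true_and, SimpleGraph.isClique_insert]
  constructor
  · rintro ⟨h1, -, h2⟩ u hu
    exact (h2 u hu (by rintro rfl; exact h1 hu)).symm
  · intro h
    exact ⟨fun hv => (h v hv).ne rfl, hσ, fun u hu _ => (h u hu).symm⟩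

theorem link_empty (Γ : NumberedGraph) : Γ.link ∅ = Finset.univ := by
  ext v
  simp [mem_link (Γ := Γ) (σ := ∅) (by simp)]

theorem card_numbers (Γ : NumberedGraph) (U : Finset Γ.V) :
    Multiset.card (Γ.numbers U) = U.card := by simp [numbers]

open Classical in
theorem IsCovering.numbers_image (hp : IsCovering k p) {U : Finset Γ.V}
    (hU : Set.InjOn p (U : Set Γ.V)) : Δ.numbers (U.image p) = Γ.numbers U := by
  rw [numbers, Finset.image_val_of_injOn hU, Multiset.map_map, numbers]
  exact Multiset.map_congr rfl fun v _ => hp.num v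

theorem IsCovering.injOn_clique (hp : IsCovering k p) {σ : Finset Γ.V}
    (hσ : Γ.graph.IsClique (σ : Set Γ.V)) : Set.InjOn p (σ : Set Γ.V) := by
  intro u hu v hv huv
  by_contra h
  exact (hp.adj _ _ (hσ hu hv h)).ne huv

open Classical in
theorem IsCovering.isClique_image (hp : IsCovering k p) {σ : Finset Γ.V}
    (hσ : Γ.graph.IsClique (σ : Set Γ.V)) : Δ.graph.IsClique ((σ.image p : Finset Δ.V) : Set Δ.V) := by
  intro a ha b hb hab
  simp only [Finset.coe_image, Set.mem_image] at ha hb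
  obtain ⟨u, hu, rfl⟩ := ha
  obtain ⟨v, hv, rfl⟩ := hb
  exact hp.adj _ _ (hσ hu hv (by rintro rfl; exact hab rfl))

-- The covering maps the link bijectively: injectively since the link lies in the neighbourhood of
-- one vertex of `σ`, surjectively by the section. For empty `σ` the link is everything and the map
-- is `k` to one.
open Classical in
theorem IsCovering.numbers_link (hp : IsCovering k p) (hk : 0 < k) (hΔ : Δ.TriangleFree)
    {σ : Finset Γ.V} (hσ : Γ.graph.IsClique (σ : Set Γ.V)) (hne : σ.Nonempty) :
    Γ.numbers (Γ.link σ) = Δ.numbers (Δ.link (σ.image p)) := by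
  obtain ⟨v, hv⟩ := hne
  rw [← hp.numbers_image (U := Γ.link σ)]
  · congr 1
    ext c
    rw [Finset.mem_image, mem_link (hp.isClique_image hσ)]
    constructor
    · rintro ⟨u, hu, rfl⟩ d hd
      obtain ⟨w, hw, rfl⟩ := Finset.mem_image.1 hd
      exact hp.adj _ _ ((mem_link hσ).1 hu w hw)
    · intro h
      obtain ⟨q, hq1, hq2, hq3⟩ := hp.exists_section hk hΔ hσ
      exact ⟨q c, (mem_link hσ).2 fun u hu => hq3 u hu c (h _ (Finset.mem_image_of_mem p hu)), hq1 c⟩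
  · intro u hu w hw
    exact hp.inj v u w ((mem_link hσ).1 hu v hv) ((mem_link hσ).1 hw v hv)

theorem IsCovering.numbers_univ (hp : IsCovering k p) :
    Γ.numbers Finset.univ = k • Δ.numbers Finset.univ := by
  classical
  have h1 : ∀ (Γ : NumberedGraph), Γ.numbers Finset.univ = ∑ v, {Γ.num v} := fun Γ => by
    rw [numbers, ← Multiset.sum_map_singleton (Multiset.map _ _), Multiset.map_map]
    rfl
  rw [h1, h1, ← Finset.sum_fiberwise _ p, Finset.smul_sum]
  refine Finset.sum_congr rfl fun c _ => ?_
  rw [← hp.card_fiber c]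
  have h2 : {v | p v = c}.ncard = (Finset.univ.filter fun v => p v = c).card := by
    rw [← Set.ncard_coe_finset]; simp
  rw [h2, ← Finset.sum_const]
  refine Finset.sum_congr rfl fun v hv => ?_
  rw [← (Finset.mem_filter.1 hv).2, hp.num]

/-- Coverings of the same degree of a link-regular triangle-free numbered graph have the same
numbers of links of cliques. -/
theorem numbers_link_eq_of_isCovering {Γ' : NumberedGraph} {p' : Γ'.V → Δ.V} (hk : 0 < k)
    (hΔ : Δ.TriangleFree) (hreg : Δ.LinkRegular) (hp : IsCovering k p) (hp' : IsCovering k p')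
    (σ : Finset Γ.V) (τ : Finset Γ'.V) (hσ : Γ.graph.IsClique (σ : Set Γ.V))
    (hτ : Γ'.graph.IsClique (τ : Set Γ'.V)) (h : Γ.numbers σ = Γ'.numbers τ) :
    Γ.numbers (Γ.link σ) = Γ'.numbers (Γ'.link τ) := by
  classical
  have hc := congrArg Multiset.card h
  rw [card_numbers, card_numbers] at hc
  rcases σ.eq_empty_or_nonempty with rfl | hne
  · obtain rfl : τ = ∅ := by simpa using hc.symm
    rw [link_empty, link_empty, hp.numbers_univ, hp'.numbers_univ]
  · have hne' : τ.Nonempty := by rw [← Finset.card_pos, ← hc]; exact hne.card_pos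
    rw [hp.numbers_link hk hΔ hσ hne, hp'.numbers_link hk hΔ hτ hne']
    refine hreg _ _ (hp.isClique_image hσ) (hp'.isClique_image hτ) ?_
    rw [hp.numbers_image (hp.injOn_clique hσ), hp'.numbers_image (hp'.injOn_clique hτ), h]

end NumberedGraph

namespace NumberedGraph

/-! ### Cycles -/

/-- Together with `mod_succ`, this reduces adjacency in cycles to linear arithmetic. -/
theorem cycleGraph_adj_iff {n : ℕ} (hn : 2 ≤ n) (u v : Fin n) :
    (SimpleGraph.cycleGraph n).Adj u v ↔
      (u.val + 1) % n = v.val ∨ (v.val + 1) % n = u.val := by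
  obtain ⟨m, rfl⟩ : ∃ m, n = m + 2 := ⟨n - 2, by omega⟩
  have key : ∀ a b : Fin (m + 2), b - a = 1 ↔ (a.val + 1) % (m + 2) = b.val := by
    intro a b
    rw [sub_eq_iff_eq_add', Fin.ext_iff, Fin.val_add, eq_comm]
    simp
  rw [SimpleGraph.cycleGraph_adj, key, key, or_comm]

theorem mod_succ {a n : ℕ} (h : a < n) : (a + 1) % n = if a + 1 = n then 0 else a + 1 := by
  split_ifs with h1
  · rw [h1, Nat.mod_self]
  · exact Nat.mod_eq_of_lt (by omega)

theorem cycleGraph_triangleFree {n : ℕ} (hn : 4 ≤ n) (a b c : Fin n)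
    (hab : (SimpleGraph.cycleGraph n).Adj a b) (hac : (SimpleGraph.cycleGraph n).Adj a c) :
    ¬ (SimpleGraph.cycleGraph n).Adj b c := by
  rw [cycleGraph_adj_iff (by omega)] at *
  rw [mod_succ a.2, mod_succ b.2] at hab
  rw [mod_succ a.2, mod_succ c.2] at hac
  rw [mod_succ b.2, mod_succ c.2]
  have := a.2; have := b.2; have := c.2
  split_ifs at * <;> omega

theorem cycle_triangleFree {n : ℕ} (hn : 4 ≤ n) (N : Fin n → ℕ) (hN : ∀ i, 2 ≤ N i) :
    (cycle n N hN).TriangleFree := cycleGraph_triangleFree hn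

theorem isCovering_copies (k : ℕ) (Γ : NumberedGraph) :
    IsCovering k (Γ := copies k Γ) (Δ := Γ) Prod.snd where
  num _ := rfl
  adj _ _ h := h.2
  inj v u u' h h' huu := Prod.ext (h.1.symm.trans h'.1) huu
  lift v c h := ⟨(v.1, c), ⟨rfl, h⟩, rfl⟩
  card_fiber c := by
    have : {v : Fin k × Γ.V | v.2 = c} = Set.range fun i : Fin k => (i, c) := by
      ext ⟨i, d⟩
      simp [eq_comm]
    change {v : Fin k × Γ.V | v.2 = c}.ncard = k
    rw [this, ← Set.image_univ,
      Set.ncard_image_of_injective _ (fun i j h => (Prod.ext_iff.1 h).1), Set.ncard_univ]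
    simp

theorem modNat_succ {k n : ℕ} (u v : Fin (k * n)) (h : (u.val + 1) % (k * n) = v.val) :
    (u.modNat.val + 1) % n = v.modNat.val := by
  rw [Fin.coe_modNat, Fin.coe_modNat, ← h, Nat.mod_mul_left_mod, Nat.mod_add_mod]

theorem isCovering_repeatedCycle {k n : ℕ} (hk : 0 < k) (hn : 4 ≤ n) (N : Fin n → ℕ)
    (hN : ∀ i, 2 ≤ N i) :
    IsCovering k (Γ := repeatedCycle k n N hN) (Δ := cycle n N hN)
      (fun j : Fin (k * n) => j.modNat) := by
  have hkn : 2 ≤ k * n := by nlinarith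
  have succ_inj : ∀ a b c : Fin n, (a.val + 1) % n = c.val → (b.val + 1) % n = c.val → a = b := by
    intro a b c h1 h2
    rw [mod_succ a.2] at h1
    rw [mod_succ b.2] at h2
    ext
    split_ifs at * <;> omega
  have hpred : ∀ v : Fin (k * n), ∃ u : Fin (k * n), (u.val + 1) % (k * n) = v.val := by
    intro v
    have hv := v.2
    by_cases h0 : v.val = 0
    · refine ⟨⟨k * n - 1, by omega⟩, ?_⟩
      rw [mod_succ (by simp; omega), if_pos (by simp; omega), h0]
    · refine ⟨⟨v.val - 1, by omega⟩, ?_⟩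
      simp only
      rw [mod_succ (by omega), if_neg (by omega)]
      omega
  constructor
  · exact fun v => rfl
  · intro (u : Fin (k * n)) (v : Fin (k * n)) h
    change (SimpleGraph.cycleGraph (k * n)).Adj _ _ at h
    rw [cycleGraph_adj_iff hkn] at h
    change (SimpleGraph.cycleGraph n).Adj _ _
    rw [cycleGraph_adj_iff (by omega)]
    exact h.imp (modNat_succ u v) (modNat_succ v u)
  · intro (v : Fin (k * n)) (u : Fin (k * n)) (u' : Fin (k * n)) h h' hp
    change (SimpleGraph.cycleGraph (k * n)).Adj _ _ at h h'
    rw [cycleGraph_adj_iff hkn] at h h'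
    -- The successor and the predecessor of `v` have residues differing by two, hence distinct
    -- modulo `n > 2`.
    have absurd_of : ∀ a b : Fin (k * n), (v.val + 1) % (k * n) = a.val →
        (b.val + 1) % (k * n) = v.val → a.modNat ≠ b.modNat := by
      intro a b ha hb hab
      have h1 := modNat_succ v a ha
      have h2 := modNat_succ b v hb
      have h3 := v.modNat.2
      have h4 := b.modNat.2
      rw [← hab] at h2 h4
      rw [mod_succ h3] at h1
      rw [mod_succ h4] at h2
      split_ifs at * <;> omega
    have hu := u.2
    have hu' := u'.2
    rcases h with h | h <;> rcases h' with h' | h'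
    · exact Fin.ext (h.symm.trans h')
    · exact absurd hp (absurd_of u u' h h')
    · exact absurd hp.symm (absurd_of u' u h' h)
    · rw [mod_succ hu] at h
      rw [mod_succ hu'] at h'
      apply Fin.ext
      split_ifs at * <;> omega
  · intro (v : Fin (k * n)) (c : Fin n) h
    change (SimpleGraph.cycleGraph n).Adj _ _ at h
    rw [cycleGraph_adj_iff (by omega)] at h
    rcases h with h | h
    · have hlt : (v.val + 1) % (k * n) < k * n := Nat.mod_lt _ (by omega)
      refine ⟨(⟨(v.val + 1) % (k * n), hlt⟩ : Fin (k * n)), ?_, ?_⟩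
      · exact (cycleGraph_adj_iff hkn _ _).2 (Or.inl rfl)
      · exact Fin.ext ((modNat_succ v ⟨_, hlt⟩ rfl).symm.trans h)
    · obtain ⟨u, hu⟩ := hpred v
      refine ⟨u, ?_, ?_⟩
      · exact (cycleGraph_adj_iff hkn _ _).2 (Or.inr hu)
      · exact succ_inj _ _ _ (modNat_succ u v hu) h
  · intro (c : Fin n)
    change {v : Fin (k * n) | v.modNat = c}.ncard = k
    have : {v : Fin (k * n) | v.modNat = c} =
        Set.range fun i : Fin k => finProdFinEquiv (i, c) := by
      ext v
      obtain ⟨⟨i, d⟩, rfl⟩ := finProdFinEquiv.surjective v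
      have h1 : (finProdFinEquiv (i, d)).modNat = d :=
        (Prod.ext_iff.1 (finProdFinEquiv.symm_apply_apply (i, d))).2
      simp [h1, eq_comm]
    rw [this, ← Set.image_univ, Set.ncard_image_of_injective _
      (fun i j h => (Prod.ext_iff.1 (finProdFinEquiv.injective h)).1), Set.ncard_univ]
    simp

/-- A cycle is connected, whereas the index of the copy is constant along walks and takes at least
two values. -/
theorem isEmpty_copies_iso_repeatedCycle {k n : ℕ} (hk : 2 ≤ k) (hn : 0 < n) (N : Fin n → ℕ)
    (hN : ∀ i, 2 ≤ N i) :
    IsEmpty ((copies k (.cycle n N hN)).graph ≃g (repeatedCycle k n N hN).graph) := by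
  refine ⟨fun f => ?_⟩
  have hc : (copies k (.cycle n N hN)).graph.Preconnected :=
    f.preconnected_iff.2 (SimpleGraph.cycleGraph_preconnected (n := k * n))
  have hfst : ∀ a b, (copies k (.cycle n N hN)).graph.Reachable a b → a.1 = b.1 := by
    rintro a b ⟨w⟩
    induction w with
    | nil => rfl
    | cons h _ ih => exact h.1.trans ih
  have := hfst ((⟨0, by omega⟩ : Fin k), (⟨0, hn⟩ : Fin n)) ((⟨1, by omega⟩ : Fin k), ⟨0, hn⟩)
    (hc _ _)
  simp at this

theorem linkRegular_of_num_injective (Γ : NumberedGraph) (h : Function.Injective Γ.num) :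
    Γ.LinkRegular := by
  intro σ τ _ _ hστ
  rw [Finset.val_injective (Multiset.map_injective h hστ)]

theorem card_eq_two_of_mem_iff_adj {m : ℕ} (v : Fin (m + 3)) (U : Finset (Fin (m + 3)))
    (h : ∀ u, u ∈ U ↔ (SimpleGraph.cycleGraph (m + 3)).Adj v u) : U.card = 2 := by
  rw [← SimpleGraph.cycleGraph_degree_three_le (v := v), ← SimpleGraph.card_neighborFinset_eq_degree]
  congr 1
  ext u
  rw [h, SimpleGraph.mem_neighborFinset]

/-- With constant numbers only cardinalities matter, and without triangles the link of a clique with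
zero, one or more vertices has `n`, two or no elements. -/
theorem cycle_linkRegular_of_const {n : ℕ} (hn : 4 ≤ n) (N : Fin n → ℕ) (hN : ∀ i, 2 ≤ N i)
    (h : ∀ i j, N i = N j) : (cycle n N hN).LinkRegular := by
  classical
  have hnum : ∀ U : Finset (cycle n N hN).V,
      (cycle n N hN).numbers U = Multiset.replicate U.card (N ⟨0, by omega⟩) := by
    intro U
    rw [numbers, Multiset.eq_replicate]
    exact ⟨by simp, by simp only [Multiset.mem_map]; rintro _ ⟨i, -, rfl⟩; exact h _ _⟩
  have hT := cycle_triangleFree hn N hN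
  have hcard : ∀ σ : Finset (cycle n N hN).V,
      (cycle n N hN).graph.IsClique (σ : Set (cycle n N hN).V) →
      ((cycle n N hN).link σ).card = if σ.card = 0 then n else if σ.card = 1 then 2 else 0 := by
    intro σ hσ
    rcases Nat.lt_or_ge 1 σ.card with h1 | h1
    · rw [if_neg (by omega), if_neg (by omega), Finset.card_eq_zero]
      obtain ⟨a, ha, b, hb, hab⟩ := Finset.one_lt_card.1 h1
      refine Finset.eq_empty_of_forall_notMem fun v hv => ?_
      have h2 := (mem_link hσ).1 hv
      exact hT a b v (hσ ha hb hab) (h2 a ha) (h2 b hb)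
    · rcases σ.eq_empty_or_nonempty with rfl | hne
      · rw [link_empty]
        exact Fintype.card_fin n
      · have h2 : σ.card = 1 := le_antisymm h1 hne.card_pos
        obtain ⟨v, rfl⟩ := Finset.card_eq_one.1 h2
        rw [if_neg (by omega), if_pos h2]
        obtain ⟨m, rfl⟩ : ∃ m, n = m + 3 := ⟨n - 3, by omega⟩
        exact card_eq_two_of_mem_iff_adj v _ fun u =>
          (mem_link hσ (v := u)).trans ⟨fun h => h v (Finset.mem_singleton_self v), fun h w hw =>
            Finset.mem_singleton.1 hw ▸ h⟩
  intro σ τ hσ hτ hστ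
  have hc := congrArg Multiset.card hστ
  rw [card_numbers, card_numbers] at hc
  rw [hnum, hnum, hcard σ hσ, hcard τ hτ, hc]

/-- Groups of numbered graphs with constant numbers `a < b` are not isomorphic. -/
theorem isEmpty_mulEquiv_of_num_const {Γ Γ' : NumberedGraph} {a b : ℕ} (hab : a < b) (ha : 0 < a)
    (h : ∀ v, Γ.num v = a) (h' : ∀ v, Γ'.num v = b) (v : Γ'.V) : IsEmpty (Γ.NGP ≃* Γ'.NGP) := by
  classical
  refine ⟨fun f => ?_⟩
  let ψ := toCyclic v b 1 (by simp [h'])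
  let θ : Γ.NGP →* Multiplicative (ZMod b) := ψ.comp f.toMonoidHom
  -- All generators of the first group have `a`-th power one, so its image in an abelian group is
  -- killed by `a`; yet `θ` reaches an element of order `b > a`.
  have hθ : (powMonoidHom a).comp θ = 1 := by
    refine PresentedGroup.ext fun u => ?_
    have := of_pow_num u
    rw [h] at this
    simp only [MonoidHom.comp_apply, powMonoidHom_apply, MonoidHom.one_apply]
    rw [← map_pow, this, map_one]
  have h1 := DFunLike.congr_fun hθ (f.symm (PresentedGroup.of v))
  have h2 : θ (f.symm (PresentedGroup.of v)) = Multiplicative.ofAdd 1 := by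
    simp [θ, ψ, toCyclic_of]
  rw [MonoidHom.comp_apply, h2, powMonoidHom_apply, ← ofAdd_nsmul] at h1
  have h3 : (a : ZMod b) = 0 := by simpa using h1
  rw [ZMod.natCast_eq_zero_iff] at h3
  exact absurd (Nat.le_of_dvd ha h3) (by omega)

theorem copies_repeatedCycle_spec {k n : ℕ} (hk : 2 ≤ k) (hn : 4 ≤ n) (N : Fin n → ℕ)
    (hN : ∀ i, 2 ≤ N i) :
    IsEmpty ((copies k (.cycle n N hN)).graph ≃g (repeatedCycle k n N hN).graph) ∧
      (copies k (.cycle n N hN)).geodesicGrowth = (repeatedCycle k n N hN).geodesicGrowth ∧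
      ((cycle n N hN).LinkRegular →
        (copies k (.cycle n N hN)).LinkRegular ∧ (repeatedCycle k n N hN).LinkRegular ∧
        (copies k (.cycle n N hN)).Equivalent (repeatedCycle k n N hN)) ∧
      ((Function.Injective N ∨ ∀ i j, N i = N j) → (cycle n N hN).LinkRegular) := by
  have hk' : 0 < k := by omega
  have hT := cycle_triangleFree hn N hN
  have h1 := isCovering_copies k (cycle n N hN)
  have h2 := isCovering_repeatedCycle hk' hn N hN
  refine ⟨isEmpty_copies_iso_repeatedCycle hk (by omega) N hN,
    geodesicGrowth_eq_of_isCovering hk' hT h1 h2, fun hreg => ⟨?_, ?_, ?_, ?_⟩, ?_⟩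
  · exact numbers_link_eq_of_isCovering hk' hT hreg h1 h1
  · exact numbers_link_eq_of_isCovering hk' hT hreg h2 h2
  · rw [h1.numbers_univ, h2.numbers_univ]
  · exact numbers_link_eq_of_isCovering hk' hT hreg h1 h2
  · rintro (h | h)
    · exact linkRegular_of_num_injective _ h
    · exact cycle_linkRegular_of_const hn N hN h

end NumberedGraph

theorem corollary5p16 :
    -- infinitely many pairs: the groups of the first members are pairwise non-isomorphic
    (∃ Γ Γ' : ℕ → NumberedGraph,
      (∀ i j, i ≠ j → IsEmpty ((Γ i).NGP ≃* (Γ j).NGP)) ∧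
      ∀ i, IsEmpty ((Γ i).graph ≃g (Γ' i).graph) ∧
        (Γ i).LinkRegular ∧ (Γ' i).LinkRegular ∧ (Γ i).Equivalent (Γ' i) ∧
        (Γ i).geodesicGrowth = (Γ' i).geodesicGrowth) ∧
    -- the example: `k` copies of a numbered `n`-cycle against the `kn`-cycle
    (∀ (k n : ℕ), 2 ≤ k → 4 ≤ n → ∀ (N : Fin n → ℕ) (hN : ∀ i, 2 ≤ N i),
      IsEmpty ((NumberedGraph.copies k (.cycle n N hN)).graph ≃g
        (NumberedGraph.repeatedCycle k n N hN).graph) ∧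
      (NumberedGraph.copies k (.cycle n N hN)).geodesicGrowth =
        (NumberedGraph.repeatedCycle k n N hN).geodesicGrowth ∧
      ((NumberedGraph.cycle n N hN).LinkRegular →
        (NumberedGraph.copies k (.cycle n N hN)).LinkRegular ∧
        (NumberedGraph.repeatedCycle k n N hN).LinkRegular ∧
        (NumberedGraph.copies k (.cycle n N hN)).Equivalent
          (NumberedGraph.repeatedCycle k n N hN)) ∧
      ((Function.Injective N ∨ ∀ i j, N i = N j) → (NumberedGraph.cycle n N hN).LinkRegular)) := by
  refine ⟨?_, fun k n hk hn N hN => NumberedGraph.copies_repeatedCycle_spec hk hn N hN⟩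
  have hN : ∀ i : ℕ, ∀ _ : Fin 4, 2 ≤ i + 2 := fun i _ => by omega
  -- Any vertex will do; it selects the cyclic quotient used to distinguish two groups.
  let v₀ : Fin 2 × Fin 4 := (0, 0)
  refine ⟨fun i => .copies 2 (.cycle 4 (fun _ => i + 2) (hN i)),
    fun i => .repeatedCycle 2 4 (fun _ => i + 2) (hN i), fun i j hij => ?_, fun i => ?_⟩
  · rcases lt_or_gt_of_ne hij with h | h
    · exact NumberedGraph.isEmpty_mulEquiv_of_num_const (a := i + 2) (b := j + 2) (by omega)
        (by omega) (fun _ => rfl) (fun _ => rfl) v₀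
    · have := NumberedGraph.isEmpty_mulEquiv_of_num_const
        (Γ := .copies 2 (.cycle 4 (fun _ => j + 2) (hN j)))
        (Γ' := .copies 2 (.cycle 4 (fun _ => i + 2) (hN i))) (a := j + 2) (b := i + 2) (by omega)
        (by omega) (fun _ => rfl) (fun _ => rfl) v₀
      exact ⟨fun f => this.false f.symm⟩
  · obtain ⟨h1, h2, h3, h4⟩ := NumberedGraph.copies_repeatedCycle_spec (k := 2) (n := 4) le_rfl
      le_rfl (fun _ => i + 2) (hN i)
    obtain ⟨h5, h6, h7⟩ := h3 (h4 (Or.inr fun _ _ => rfl))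
    exact ⟨h1, h5, h6, h7, h2⟩
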